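/- Let $(\mathbb K,|\cdot|)$ be an algebraically closed field with an absolute value, let $f\in\mathbb K[z]$ be a polynomial of degree $n\ge 2$ with leading coefficient $a_0$, and let $N\ge 1$ be an integer. For $x\in\mathbb K^n$ with pairwise distinct components put, for $i=1,\dots,n$, $$W_i(x)=\frac{f(x_i)}{a_0\prod_{j\ne i}(x_i-x_j)},\qquad d_i(x)=\min_{j\ne i}|x_i-x_j|,\qquad E_f(x)=\max_{1\le i\le n}\frac{|W_i(x)|}{d_i(x)}.$$ Define the Ehrlich-type iteration functions $T^{(m)}\colon D_m\subset\mathbb K^n\to\mathbb K^n$ recursively by $D_0=\mathbb K^n$, $T^{(0)}(x)=x$ and $$T^{(m+1)}_i(x)=x_i-\frac{f(x_i)}{f'(x_i)-f(x_i)\sum_{j\ne i}\frac{1}{x_i-T^{(m)}_j(x)}}\qquad(i=1,\dots,n),$$ where $D_{m+1}$ is the set of all $x\in D_m$ such that $x_i\ne T^{(m)}_j(x)$ for all $i\ne j$ and $f'(x_i)-f(x_i)\sum_{j\ne i}\frac{1}{x_i-T^{(m)}_j(x)}\ne 0$ for all $i$. Suppose that $x^{(0)}\in\mathbb K^n$ has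 pairwise distinct components and $$E_f(x^{(0)})=\left\|\frac{W(x^{(0)})}{d(x^{(0)})}\right\|_\infty<\frac{8}{(3+\sqrt{8n-7})^2}.$$ Then: 1. $f$ has only simple zeros in $\mathbb K$. 2. The iteration $x^{(k+1)}=T^{(N)}(x^{(k)})$, $k=0,1,2,\dots$, is well-defined, i.e. $x^{(k)}\in D_N$ for all $k\ge 0$ (in particular every $x^{(k)}$ has pairwise distinct components). 3. There is a root-vector $\xi\in\mathbb K^n$ of $f$ (i.e. $f(z)=c\prod_{i=1}^n(z-\xi_i)$ for all $z\in\mathbb K$, with some $c\in\mathbb K$) such that $x^{(k)}\to\xi$ with order of convergence (at least) $2N+1$, i.e. $\|x^{(k+1)}-\xi\|_\infty\le C\,\|x^{(k)}-\xi\|_\infty^{2N+1}$ for all $k\ge 0$ with some constant $C$ independent of $k$; and, for every $k\ge 0$ such that $E_f(x^{(k)})<8/(3+\sqrt{8n-7})^2$, the a posteriori error estimate $$|x_i^{(k)}-\xi_i|\le\alpha\bigl(E_f(x^{(k)})\bigr)\,|W_i(x^{(k)})|\qquad(i=1,\dots,n)$$ holds, where $$\alpha(t)=\frac{2}{1-(n-2)t+\sqrt{(1-(n-2)t)^2-4t}}.$$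 -/

import Mathlib

open Polynomial Filter Topology

namespace EhrlichType

noncomputable section

variable {K : Type*} [NormedField K] {n : ℕ}

/-- `ξ` is a root-vector of `f`: `f(z) = a₀ ∏ (z - ξ i)` for all `z`. -/
def IsRootVector (f : K[X]) (ξ : Fin n → K) : Prop :=
  ∃ a₀ : K, ∀ z : K, f.eval z = a₀ * ∏ i, (z - ξ i)

/-- Every zero of `f` in `K` is simple. -/
def HasOnlySimpleZeros (f : K[X]) : Prop :=
  ∀ z : K, f.IsRoot z → f.rootMultiplicity z = 1

/-- The Weierstrass correction, meaningful for vectors with distinct components. -/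
def weierstrass (f : K[X]) (x : Fin n → K) : Fin n → K := fun i =>
  f.eval (x i) / (f.leadingCoeff * ∏ j ∈ Finset.univ.erase i, (x i - x j))

/-- `d i (x) = min_{j ≠ i} |x i - x j|` (the index set is finite, and nonempty when `2 ≤ n`). -/
def minDist (x : Fin n → K) : Fin n → ℝ := fun i =>
  ⨅ j : {j : Fin n // j ≠ i}, ‖x i - x j‖

/-- The vector `x / y = (|x 1| / y 1, …, |x n| / y n)` in `ℝ^n`. -/
def quot (x : Fin n → K) (y : Fin n → ℝ) : Fin n → ℝ := fun i => ‖x i‖ / y i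

/-- `E_f(x) = ‖W_f(x) / d(x)‖_∞`; the norm on `Fin n → ℝ` is the maximum norm. -/
def initialFn (f : K[X]) (x : Fin n → K) : ℝ := ‖quot (weierstrass f x) (minDist x)‖

/-- The relation `x # y`: `x i ≠ y j` whenever `i ≠ j`. -/
def Sep (x y : Fin n → K) : Prop := ∀ i j : Fin n, i ≠ j → x i ≠ y j

/-- `f'(x i) - f(x i) ∑_{j ≠ i} 1 / (x i - y j)`, the denominator of the Ehrlich-type correction. -/
def denom (f : K[X]) (x y : Fin n → K) (i : Fin n) : K :=
  f.derivative.eval (x i) - f.eval (x i) * ∑ j ∈ Finset.univ.erase i, 1 / (x i - y j)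

/-- The iteration functions `T^(N)`; only their values on `domain f N` are meaningful. -/
def iterFn (f : K[X]) : ℕ → (Fin n → K) → (Fin n → K)
  | 0, x => x
  | N + 1, x => fun i => x i - f.eval (x i) / denom f x (iterFn f N x) i

/-- The domains `D_N` of the iteration functions `T^(N)`. -/
def domain (f : K[X]) : ℕ → Set (Fin n → K)
  | 0 => Set.univ
  | N + 1 => {x | x ∈ domain f N ∧ Sep x (iterFn f N x) ∧
      ∀ i, denom f x (iterFn f N x) i ≠ 0}

/-- The `k`-th iterate `x^(k)` of the `N`-th Ehrlich-type method started at `x₀`. -/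
def iterate (f : K[X]) (N : ℕ) (x₀ : Fin n → K) (k : ℕ) : Fin n → K :=
  (iterFn f N)^[k] x₀

/-- `x` converges to `ξ` with order of convergence (at least) `r`, in the sense of Q-order. -/
def ConvergesWithOrder (r : ℕ) (x : ℕ → Fin n → K) (ξ : Fin n → K) : Prop :=
  Tendsto x atTop (𝓝 ξ) ∧ ∃ C : ℝ, ∀ k, ‖x (k + 1) - ξ‖ ≤ C * ‖x k - ξ‖ ^ r

/-- The function `α` for `p = ∞`, where `a = n - 1`. -/
def alpha (n : ℕ) (t : ℝ) : ℝ :=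
  2 / (1 - ((n : ℝ) - 2) * t + √((1 - ((n : ℝ) - 2) * t) ^ 2 - 4 * t))

end

end EhrlichType

namespace EhrlichType

variable {K : Type*} [NormedField K] {n : ℕ}

/-! Put `s = √(8n - 7)`, so that `n - 1 = (s² - 1)/8`, and `R = 2/(3 + s)`; the threshold is `2R²`.

Interpolating `f` at the components of `x` shows that the zeros of `f` near `x i` are the fixed
points of `z ↦ x i - W i / (1 + ∑ W j / (z - x j))`. Below the threshold this map contracts the disc
of radius `α ‖W i‖` about `x i` (`exists_root_near`). `K` need not be complete; instead `f` tends to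
`0` along the iterates, and since `f` splits it must have a zero in the disc. By `alpha_spec` this
gives zeros with `‖x i - ξ i‖ ≤ R ‖x i - x j‖`. As `R ≤ 1/3`, they are distinct, hence all the
zeros, all simple.

From then on only this closeness to `ξ` matters. For `m ≥ 1`, `T^(m)` shrinks each error by the
factor `β = (s - 1)/(s + 7)`, and separations shrink by at most the same `β`, so closeness is
preserved (`iterFn_succ_spec`, `near_of_contract`). The error of `T^(m+1)` is bounded by a constant
times the square of the error of `x` times the error of `T^(m)`; this gives order `2N + 1`. -/

/-! ### Interpolation and Weierstrass corrections. -/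

/-- Lagrange interpolation of `f` at the components of `x`, in terms of Weierstrass corrections. -/
theorem eval_eq_weierstrass (f : K[X]) (hf : f.natDegree = n) (h0 : f ≠ 0) {x : Fin n → K}
    (hx : Function.Injective x) (z : K) :
    f.eval z = f.leadingCoeff * (∏ j, (z - x j) +
      ∑ i, weierstrass f x i * ∏ j ∈ Finset.univ.erase i, (z - x j)) := by
  set P : K[X] := ∏ j, (X - C (x j)) with hP
  set Q : K[X] := ∑ i, C (weierstrass f x i) * ∏ j ∈ Finset.univ.erase i, (X - C (x j)) with hQ
  have hlc : f.leadingCoeff ≠ 0 := leadingCoeff_ne_zero.mpr h0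
  have hPm : P.Monic := monic_prod_of_monic _ _ fun j _ => monic_X_sub_C _
  have hPd : P.natDegree = n := by
    rw [hP, natDegree_prod_of_monic _ _ fun j _ => monic_X_sub_C _]; simp
  have hPdeg : P.degree = n := by rw [degree_eq_natDegree hPm.ne_zero, hPd]
  have hfdeg : f.degree = n := by rw [degree_eq_natDegree h0, hf]
  have h1 : (f - C f.leadingCoeff * P).degree < n := by
    rw [← hfdeg]
    refine degree_sub_lt_left ?_ h0 ?_
    · rw [degree_C_mul hlc, hPdeg, hfdeg]
    · rw [leadingCoeff_mul, leadingCoeff_C, hPm.leadingCoeff, mul_one]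
  have h2 : (C f.leadingCoeff * Q).degree < n := by
    rw [degree_C_mul hlc, hQ]
    refine (degree_sum_le _ _).trans_lt ?_
    refine (Finset.sup_lt_iff (WithBot.bot_lt_coe n)).mpr ?_
    intro i _
    rw [← smul_eq_C_mul]
    refine (degree_smul_le _ _).trans_lt ?_
    have hm : (∏ j ∈ Finset.univ.erase i, (X - C (x j))).Monic :=
      monic_prod_of_monic _ _ fun j _ => monic_X_sub_C _
    rw [degree_eq_natDegree hm.ne_zero, natDegree_prod_of_monic _ _ fun j _ => monic_X_sub_C _]
    have : 0 < n := i.pos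
    simp only [natDegree_X_sub_C, Finset.sum_const, Finset.card_erase_of_mem (Finset.mem_univ i),
      Finset.card_univ, Fintype.card_fin, smul_eq_mul, mul_one]
    exact WithBot.coe_lt_coe.mpr (Nat.sub_lt this one_pos)
  -- Both sides have degree below `n` and agree at the `n` distinct nodes.
  have key : f - C f.leadingCoeff * P = C f.leadingCoeff * Q := by
    refine eq_of_degrees_lt_of_eval_index_eq (s := Finset.univ) (v := x) hx.injOn
      (by simpa using h1) (by simpa using h2) ?_
    intro k _
    have hPk : P.eval (x k) = 0 := by
      rw [hP, eval_prod]
      exact Finset.prod_eq_zero (Finset.mem_univ k) (by simp)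
    have hQk : Q.eval (x k) =
        weierstrass f x k * ∏ j ∈ Finset.univ.erase k, (x k - x j) := by
      rw [hQ, eval_finsetSum, Finset.sum_eq_single k]
      · simp [eval_prod]
      · intro i _ hik
        rw [eval_mul, eval_prod]
        rw [Finset.prod_eq_zero (Finset.mem_erase.mpr ⟨hik.symm, Finset.mem_univ k⟩) (by simp),
          mul_zero]
      · simp
    have hne : ∏ j ∈ Finset.univ.erase k, (x k - x j) ≠ 0 :=
      Finset.prod_ne_zero_iff.mpr fun j hj =>
        sub_ne_zero.mpr fun h => Finset.ne_of_mem_erase hj (hx h).symm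
    rw [eval_sub, eval_mul, eval_mul, eval_C, hPk, hQk, weierstrass]
    field_simp
    ring
  have := congrArg (eval z) key
  simp only [eval_sub, eval_mul, eval_C, hP, hQ, eval_prod, eval_finsetSum, eval_X] at this
  linear_combination this

/-- The last factor vanishes, when `1 + ∑ ≠ 0`, exactly at the fixed points of `z ↦ x i - W i / (1 +
∑)`, the map iterated in `exists_root_near`. -/
theorem eval_eq_mul_weierstrass_sum (f : K[X]) (hf : f.natDegree = n) (h0 : f ≠ 0)
    {x : Fin n → K} (hx : Function.Injective x) (i : Fin n) {z : K}
    (hz : ∀ j, j ≠ i → z ≠ x j) :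
    f.eval z = f.leadingCoeff * (∏ j ∈ Finset.univ.erase i, (z - x j)) *
      ((z - x i) * (1 + ∑ j ∈ Finset.univ.erase i, weierstrass f x j / (z - x j)) +
        weierstrass f x i) := by
  rw [eval_eq_weierstrass f hf h0 hx z, ← Finset.mul_prod_erase _ _ (Finset.mem_univ i),
    ← Finset.add_sum_erase _ _ (Finset.mem_univ i)]
  have : ∑ k ∈ Finset.univ.erase i,
      weierstrass f x k * ∏ j ∈ Finset.univ.erase k, (z - x j) =
      (∏ j ∈ Finset.univ.erase i, (z - x j)) * ((z - x i) *
        ∑ j ∈ Finset.univ.erase i, weierstrass f x j / (z - x j)) := by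
    rw [Finset.mul_sum, Finset.mul_sum]
    refine Finset.sum_congr rfl fun k hk => ?_
    have hki := Finset.ne_of_mem_erase hk
    have hzk : z - x k ≠ 0 := sub_ne_zero.mpr (hz k hki)
    have h1 := Finset.mul_prod_erase Finset.univ (fun j => z - x j) (Finset.mem_univ k)
    have h2 := Finset.mul_prod_erase Finset.univ (fun j => z - x j) (Finset.mem_univ i)
    have h3 := h1.trans h2.symm
    field_simp
    linear_combination weierstrass f x k * h3
  rw [this]
  ring

/-! ### Existence of zeros in discs. -/

theorem pow_card_le_norm_prod_sub (s : Multiset K) (z : K) {c : ℝ} (hc : 0 ≤ c)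
    (h : ∀ a ∈ s, c ≤ ‖z - a‖) : c ^ Multiset.card s ≤ ‖(s.map (z - ·)).prod‖ := by
  induction s using Multiset.induction_on with
  | empty => simp
  | cons a s ih =>
    rw [Multiset.map_cons, Multiset.prod_cons, Multiset.card_cons, norm_mul, pow_succ']
    exact mul_le_mul (h a (Multiset.mem_cons_self a s))
      (ih fun b hb => h b (Multiset.mem_cons_of_mem hb)) (by positivity) (norm_nonneg _)

/-- If `f` takes arbitrarily small values on a closed disc, it has a zero in that disc. -/
theorem exists_root_of_tendsto [IsAlgClosed K] (f : K[X]) (h0 : f ≠ 0) (z : ℕ → K) (w : K)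
    (ρ : ℝ) (hz : ∀ k, ‖z k - w‖ ≤ ρ) (hlim : Tendsto (fun k => f.eval (z k)) atTop (𝓝 0)) :
    ∃ ξ, f.IsRoot ξ ∧ ‖w - ξ‖ ≤ ρ := by
  classical
  by_contra! hcon
  -- Finitely many zeros outside the disc leave a uniform gap, which bounds `‖f‖` below on the disc.
  obtain ⟨c, hc, hcr⟩ : ∃ c : ℝ, 0 < c ∧ ∀ a ∈ f.roots, c ≤ ‖w - a‖ - ρ := by
    rcases f.roots.toFinset.eq_empty_or_nonempty with he | hne
    · refine ⟨1, one_pos, fun a ha => ?_⟩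
      have : a ∈ f.roots.toFinset := Multiset.mem_toFinset.mpr ha
      simp [he] at this
    · obtain ⟨b, hb, hmin⟩ := Finset.exists_min_image _ (fun a => ‖w - a‖ - ρ) hne
      refine ⟨‖w - b‖ - ρ, ?_, fun a ha => hmin a (Multiset.mem_toFinset.mpr ha)⟩
      exact sub_pos.mpr (hcon b (isRoot_of_mem_roots (Multiset.mem_toFinset.mp hb)))
  have hlc : 0 < ‖f.leadingCoeff‖ := norm_pos_iff.mpr (leadingCoeff_ne_zero.mpr h0)
  have hb : ∀ k, ‖f.leadingCoeff‖ * c ^ Multiset.card f.roots ≤ ‖f.eval (z k)‖ := by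
    intro k
    have he := (IsAlgClosed.splits f).eval_eq_prod_roots (z k)
    rw [he, norm_mul]
    refine mul_le_mul_of_nonneg_left (pow_card_le_norm_prod_sub _ _ hc.le fun a ha => ?_) hlc.le
    have h1 := hcr a ha
    have h2 := norm_sub_le_norm_sub_add_norm_sub w (z k) a
    have h3 := hz k
    rw [norm_sub_rev] at h3
    linarith
  have hl := hlim.norm
  rw [norm_zero] at hl
  have := ge_of_tendsto' hl hb
  have : 0 < ‖f.leadingCoeff‖ * c ^ Multiset.card f.roots := by positivity
  linarith

/-- The part of Banach's argument that needs no completeness: the iterates stay in the disc and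
their steps decay geometrically, but no limit is claimed. -/
theorem iterate_mem_and_norm_sub_le (G : K → K) (w : K) {ρ q : ℝ} (hρ : 0 ≤ ρ) (hq : 0 ≤ q)
    (hG : ∀ z, ‖z - w‖ ≤ ρ → ‖G z - w‖ ≤ ρ)
    (hL : ∀ y z, ‖y - w‖ ≤ ρ → ‖z - w‖ ≤ ρ → ‖G y - G z‖ ≤ q * ‖y - z‖) (k : ℕ) :
    ‖G^[k] w - w‖ ≤ ρ ∧ ‖G^[k + 1] w - G^[k] w‖ ≤ q ^ k * ρ := by
  have hmem : ∀ k, ‖G^[k] w - w‖ ≤ ρ := by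
    intro k
    induction k with
    | zero => simpa using hρ
    | succ k ih => rw [Function.iterate_succ_apply']; exact hG _ ih
  refine ⟨hmem k, ?_⟩
  induction k with
  | zero => simpa using hmem 1
  | succ k ih =>
    rw [Function.iterate_succ_apply' G (k + 1), Function.iterate_succ_apply' G k]
    have h1 := hL _ _ (hmem (k + 1)) (hmem k)
    rw [Function.iterate_succ_apply' G k] at h1 ih
    calc _ ≤ _ := h1
      _ ≤ q * (q ^ k * ρ) := by gcongr
      _ = _ := by ring

theorem cast_card_univ_erase (i : Fin n) : ((Finset.univ.erase i).card : ℝ) = n - 1 := by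
  have : 1 ≤ n := i.pos
  rw [Finset.card_erase_of_mem (Finset.mem_univ i), Finset.card_univ, Fintype.card_fin]
  push_cast [this]
  ring

/-- If the Weierstrass corrections are small relative to the separation of `x`, then each disc
with centre `x i` and radius `α * ‖W i‖` contains a zero of `f`. -/
theorem exists_root_near [IsAlgClosed K] (f : K[X]) (hf : f.natDegree = n) (h0 : f ≠ 0)
    {x : Fin n → K} (hx : Function.Injective x) {t α : ℝ} (ht : 0 ≤ t) (hα : 0 < α)
    (hW : ∀ i j, i ≠ j → ‖weierstrass f x i‖ ≤ t * ‖x i - x j‖)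
    (hr : α * t < 1) (hαt : α * (1 - α * t - (n - 1) * t) = 1 - α * t)
    (hq : (n - 1) * (α * t) ^ 2 < (1 - α * t) ^ 2) (i : Fin n) :
    ∃ ξ, f.IsRoot ξ ∧ ‖x i - ξ‖ ≤ α * ‖weierstrass f x i‖ := by
  set W := weierstrass f x with hWdef
  set ρ := α * ‖W i‖ with hρ
  have hρ0 : 0 ≤ ρ := by positivity
  have hr' : 0 < 1 - α * t := by linarith
  have hn : (0 : ℝ) ≤ n - 1 := by
    have : (1 : ℝ) ≤ n := by exact_mod_cast i.pos
    linarith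
  have hpos : ∀ j, j ≠ i → 0 < ‖x i - x j‖ := fun j hj =>
    norm_pos_iff.mpr (sub_ne_zero.mpr fun h => hj (hx h).symm)
  have hsep : ∀ z, ‖z - x i‖ ≤ ρ → ∀ j, j ≠ i →
      (1 - α * t) * ‖x i - x j‖ ≤ ‖z - x j‖ := by
    intro z hz j hj
    have h1 := norm_sub_le_norm_sub_add_norm_sub (x i) z (x j)
    have h2 : ρ ≤ α * (t * ‖x i - x j‖) := by
      rw [hρ]; exact mul_le_mul_of_nonneg_left (hW i j hj.symm) hα.le
    rw [norm_sub_rev] at hz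
    linarith
  have hne : ∀ z, ‖z - x i‖ ≤ ρ → ∀ j, j ≠ i → z - x j ≠ 0 := by
    intro z hz j hj
    have := hsep z hz j hj
    have := mul_pos hr' (hpos j hj)
    exact norm_pos_iff.mp (by linarith)
  set S : K → K := fun z => ∑ j ∈ Finset.univ.erase i, W j / (z - x j) with hS
  set c := (n - 1) * (t / (1 - α * t)) with hc
  have hc0 : 0 ≤ c := by positivity
  have hSle : ∀ z, ‖z - x i‖ ≤ ρ → ‖S z‖ ≤ c := by
    intro z hz
    calc ‖S z‖ ≤ ∑ j ∈ Finset.univ.erase i, ‖W j / (z - x j)‖ := norm_sum_le _ _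
      _ ≤ ∑ j ∈ Finset.univ.erase i, t / (1 - α * t) := by
        refine Finset.sum_le_sum fun j hj => ?_
        have hji := Finset.ne_of_mem_erase hj
        have h1 := hsep z hz j hji
        have h2 := hW j i hji
        rw [norm_sub_rev] at h2
        have h3 := hpos j hji
        have h4 := mul_pos hr' h3
        rw [norm_div, div_le_div_iff₀ (by linarith) hr']
        calc ‖W j‖ * (1 - α * t) ≤ t * ‖x i - x j‖ * (1 - α * t) := by gcongr
          _ = t * ((1 - α * t) * ‖x i - x j‖) := by ring
          _ ≤ t * ‖z - x j‖ := by gcongr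
      _ = c := by rw [Finset.sum_const, nsmul_eq_mul, cast_card_univ_erase]
  -- `hαt` is the fixed-point equation `α = 1 / (1 - c)` for the radius; it makes `G` map the disc
  -- into itself.
  have hcα : 1 - c = 1 / α := by
    have hcr : c * (1 - α * t) = (n - 1) * t := by
      rw [hc, mul_assoc, div_mul_cancel₀ _ hr'.ne']
    rw [eq_div_iff hα.ne']
    refine mul_right_cancel₀ hr'.ne' ?_
    linear_combination hαt - α * hcr
  have hden : ∀ z, ‖z - x i‖ ≤ ρ → 1 / α ≤ ‖1 + S z‖ := by
    intro z hz
    have h1 := norm_sub_le_norm_add (1 : K) (S z)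
    rw [norm_one] at h1
    linarith [hSle z hz]
  have hden0 : ∀ z, ‖z - x i‖ ≤ ρ → 1 + S z ≠ 0 := fun z hz =>
    norm_pos_iff.mp (lt_of_lt_of_le (by positivity) (hden z hz))
  have hinv : ∀ z, ‖z - x i‖ ≤ ρ → ‖(1 + S z)⁻¹‖ ≤ α := by
    intro z hz
    rw [norm_inv]
    have := inv_anti₀ (by positivity) (hden z hz)
    simpa using this
  set G : K → K := fun z => x i - W i / (1 + S z) with hG
  have hGmem : ∀ z, ‖z - x i‖ ≤ ρ → ‖G z - x i‖ ≤ ρ := by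
    intro z hz
    have : G z - x i = -(W i * (1 + S z)⁻¹) := by rw [hG]; simp [div_eq_mul_inv]
    rw [this, norm_neg, norm_mul, hρ, mul_comm]
    exact mul_le_mul_of_nonneg_right (hinv z hz) (norm_nonneg _)
  set q := (n - 1) * (α * t) ^ 2 / (1 - α * t) ^ 2 with hqd
  have hq0 : 0 ≤ q := by positivity
  have hq1 : q < 1 := by rw [hqd, div_lt_one (by positivity)]; exact hq
  have hGlip : ∀ y z, ‖y - x i‖ ≤ ρ → ‖z - x i‖ ≤ ρ → ‖G y - G z‖ ≤ q * ‖y - z‖ := by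
    intro y z hy hz
    have e1 : S y - S z = -(y - z) *
        ∑ j ∈ Finset.univ.erase i, W j / ((y - x j) * (z - x j)) := by
      rw [hS, Finset.mul_sum, ← Finset.sum_sub_distrib]
      refine Finset.sum_congr rfl fun j hj => ?_
      have hji := Finset.ne_of_mem_erase hj
      have := hne y hy j hji
      have := hne z hz j hji
      field_simp
      ring
    -- `W i` goes inside the sum: in `‖W i‖ ‖W j‖ ≤ t² ‖x i - x j‖²` the distances cancel against
    -- the denominators.
    have e2 : G y - G z = -(y - z) *
        (∑ j ∈ Finset.univ.erase i, W i * (W j / ((y - x j) * (z - x j)))) *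
        (1 + S y)⁻¹ * (1 + S z)⁻¹ := by
      rw [← Finset.mul_sum]
      have h1 := hden0 y hy
      have h2 := hden0 z hz
      have : G y - G z = W i * (S y - S z) * (1 + S y)⁻¹ * (1 + S z)⁻¹ := by
        rw [hG]
        field_simp
        ring
      rw [this, e1]
      ring
    have e3 : ‖∑ j ∈ Finset.univ.erase i, W i * (W j / ((y - x j) * (z - x j)))‖ ≤
        (n - 1) * (t ^ 2 / (1 - α * t) ^ 2) := by
      calc _ ≤ ∑ j ∈ Finset.univ.erase i, ‖W i * (W j / ((y - x j) * (z - x j)))‖ :=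
            norm_sum_le _ _
        _ ≤ ∑ j ∈ Finset.univ.erase i, t ^ 2 / (1 - α * t) ^ 2 := by
          refine Finset.sum_le_sum fun j hj => ?_
          have hji := Finset.ne_of_mem_erase hj
          have hy1 := hsep y hy j hji
          have hz1 := hsep z hz j hji
          have h1 := hW i j hji.symm
          have h2 := hW j i hji
          rw [norm_sub_rev (x j)] at h2
          have h3 := mul_pos hr' (hpos j hji)
          rw [norm_mul, norm_div, norm_mul, ← mul_div_assoc]
          calc ‖W i‖ * ‖W j‖ / (‖y - x j‖ * ‖z - x j‖)
              ≤ (t * ‖x i - x j‖) * (t * ‖x i - x j‖) /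
                (((1 - α * t) * ‖x i - x j‖) * ((1 - α * t) * ‖x i - x j‖)) := by gcongr
            _ = _ := by
              have := hpos j hji
              field_simp
        _ = _ := by rw [Finset.sum_const, nsmul_eq_mul, cast_card_univ_erase]
    rw [e2, norm_mul, norm_mul, norm_mul, norm_neg]
    calc _ ≤ ‖y - z‖ * ((n - 1) * (t ^ 2 / (1 - α * t) ^ 2)) * α * α := by
          gcongr
          exacts [hinv y hy, hinv z hz]
      _ = q * ‖y - z‖ := by rw [hqd]; ring
  have hit := iterate_mem_and_norm_sub_le G (x i) hρ0 hq0 hGmem hGlip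
  refine (exists_root_of_tendsto f h0 (fun k => G^[k] (x i)) (x i) ρ (fun k => (hit k).1) ?_)
  set M := ∏ j ∈ Finset.univ.erase i, (ρ + ‖x i - x j‖) with hM
  have hbound : ∀ k, ‖f.eval (G^[k] (x i))‖ ≤
      ‖f.leadingCoeff‖ * M * ((1 + c) * ρ) * q ^ k := by
    intro k
    obtain ⟨hz, hd⟩ := hit k
    rw [Function.iterate_succ_apply'] at hd
    generalize G^[k] (x i) = z at hz hd
    have e := eval_eq_mul_weierstrass_sum f hf h0 hx i
      (fun j hj => sub_ne_zero.mp (hne z hz j hj))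
    -- Bounds `f` at an iterate by the length of the next step.
    have e' : (z - x i) * (1 + S z) + W i = -((1 + S z) * (G z - z)) := by
      have h1 := hden0 z hz
      rw [hG]
      field_simp
      ring
    rw [e, e', norm_mul, norm_mul, norm_neg, norm_mul, norm_prod]
    have h1 : ‖1 + S z‖ ≤ 1 + c := by
      have h1 := norm_add_le (1 : K) (S z)
      rw [norm_one] at h1
      linarith [hSle z hz]
    have h2 : ∏ j ∈ Finset.univ.erase i, ‖z - x j‖ ≤ M := by
      refine Finset.prod_le_prod (fun _ _ => norm_nonneg _) fun j _ => ?_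
      have := norm_sub_le_norm_sub_add_norm_sub z (x i) (x j)
      linarith
    calc _ ≤ ‖f.leadingCoeff‖ * M * ((1 + c) * (q ^ k * ρ)) := by gcongr
      _ = _ := by ring
  refine squeeze_zero_norm hbound ?_
  simpa using (tendsto_pow_atTop_nhds_zero_of_lt_one hq0 hq1).const_mul
    (‖f.leadingCoeff‖ * M * ((1 + c) * ρ))

/-! ### Factorization and simplicity of the zeros. -/

theorem map_eq_roots (f : K[X]) (hf : f.natDegree = n) (h0 : f ≠ 0)
    {ξ : Fin n → K} (hξ : Function.Injective ξ) (hr : ∀ i, f.IsRoot (ξ i)) :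
    Finset.univ.val.map ξ = f.roots := by
  refine Multiset.eq_of_le_of_card_le ?_ (by simpa [hf] using f.card_roots')
  rw [Multiset.le_iff_subset (Multiset.Nodup.map hξ Finset.univ.nodup)]
  intro a ha
  obtain ⟨i, -, rfl⟩ := Multiset.mem_map.mp ha
  exact (mem_roots h0).mpr (hr i)

theorem eq_C_mul_prod_of_roots (f : K[X]) (hf : f.natDegree = n) (h0 : f ≠ 0)
    {ξ : Fin n → K} (hξ : Function.Injective ξ) (hr : ∀ i, f.IsRoot (ξ i)) :
    f = C f.leadingCoeff * ∏ i, (X - C (ξ i)) := by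
  have heq := map_eq_roots f hf h0 hξ hr
  have hcard : Multiset.card f.roots = f.natDegree := by rw [← heq, hf]; simp
  have := (C_leadingCoeff_mul_prod_multiset_X_sub_C hcard).symm
  rw [← heq, Multiset.map_map] at this
  exact this

theorem hasOnlySimpleZeros_of_roots (f : K[X]) (hf : f.natDegree = n) (h0 : f ≠ 0)
    {ξ : Fin n → K} (hξ : Function.Injective ξ) (hr : ∀ i, f.IsRoot (ξ i)) :
    HasOnlySimpleZeros f := by
  classical
  have hnd : f.roots.Nodup :=
    map_eq_roots f hf h0 hξ hr ▸ Multiset.Nodup.map hξ Finset.univ.nodup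
  intro z hz
  rw [← count_roots]
  exact Multiset.count_eq_one_of_mem hnd ((mem_roots h0).mpr hz)

/-! ### One Ehrlich-type correction. -/

/-- With `y = ξ` the correction would be exactly `x i - ξ i`; the sum measures the deviation and is
linear in the errors of `y` up to its denominators. No division by `x i - ξ i` occurs, so `x i = ξ
i` is allowed. -/
theorem denom_eq_mul_one_sub {f : K[X]} {a : K} {ξ : Fin n → K}
    (hf : f = C a * ∏ i, (X - C (ξ i))) {x y : Fin n → K} (i : Fin n)
    (hx : ∀ j, j ≠ i → x i - ξ j ≠ 0) (hy : ∀ j, j ≠ i → x i - y j ≠ 0) :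
    denom f x y i = a * (∏ j ∈ Finset.univ.erase i, (x i - ξ j)) *
      (1 - (x i - ξ i) *
        ∑ j ∈ Finset.univ.erase i, (ξ j - y j) * -1 / ((x i - ξ j) * (x i - y j))) := by
  have hd : f.derivative.eval (x i) = a * ((∏ j ∈ Finset.univ.erase i, (x i - ξ j)) *
      (1 + (x i - ξ i) * ∑ k ∈ Finset.univ.erase i, 1 / (x i - ξ k))) := by
    have hk : ∀ k ∈ Finset.univ.erase i, ∏ j ∈ Finset.univ.erase k, (x i - ξ j) =
        (∏ j ∈ Finset.univ.erase i, (x i - ξ j)) * (x i - ξ i) * (1 / (x i - ξ k)) := by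
      intro k hk
      have hne := hx k (Finset.ne_of_mem_erase hk)
      have h1 := Finset.mul_prod_erase Finset.univ (fun j => x i - ξ j) (Finset.mem_univ k)
      have h2 := Finset.mul_prod_erase Finset.univ (fun j => x i - ξ j) (Finset.mem_univ i)
      have h3 := h1.trans h2.symm
      field_simp
      linear_combination h3
    rw [hf, derivative_C_mul, derivative_prod_finset]
    simp only [eval_mul, eval_C, eval_finsetSum, eval_prod, eval_sub, eval_X, derivative_sub,
      derivative_X, derivative_C, sub_zero, mul_one]
    rw [← Finset.add_sum_erase _ _ (Finset.mem_univ i), Finset.sum_congr rfl hk,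
      ← Finset.mul_sum]
    ring
  have he : f.eval (x i) =
      a * ((x i - ξ i) * ∏ j ∈ Finset.univ.erase i, (x i - ξ j)) := by
    rw [Finset.mul_prod_erase Finset.univ (fun j => x i - ξ j) (Finset.mem_univ i), hf]
    simp [eval_prod]
  have hs : ∑ j ∈ Finset.univ.erase i, (ξ j - y j) * -1 / ((x i - ξ j) * (x i - y j)) =
      ∑ j ∈ Finset.univ.erase i, 1 / (x i - y j) -
        ∑ j ∈ Finset.univ.erase i, 1 / (x i - ξ j) := by
    rw [← Finset.sum_sub_distrib]
    refine Finset.sum_congr rfl fun j hj => ?_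
    have h1 := hx j (Finset.ne_of_mem_erase hj)
    have h2 := hy j (Finset.ne_of_mem_erase hj)
    field_simp
    ring
  rw [denom, hd, he, hs]
  ring

/-- One Ehrlich-type correction: well-definedness and error bounds. -/
theorem ehrlich_step {f : K[X]} {a : K} {ξ : Fin n → K} (ha : a ≠ 0)
    (hf : f = C a * ∏ i, (X - C (ξ i))) {x y : Fin n → K} (hxi : Function.Injective x)
    {R b c θ : ℝ} (hR0 : 0 ≤ R) (hR : R < 1) (hb : 0 ≤ b) (hc : 0 < c) (hθ : θ < 1)
    (hx : ∀ i j, i ≠ j → ‖x i - ξ i‖ ≤ R * ‖x i - x j‖)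
    (hyξ : ∀ j, ‖y j - ξ j‖ ≤ b * ‖x j - ξ j‖)
    (hxy : ∀ i j, i ≠ j → c * ‖x i - x j‖ ≤ ‖x i - y j‖)
    (hbc : (n - 1) * (b * R ^ 2) ≤ θ * ((1 - R) * c)) (i : Fin n) :
    denom f x y i ≠ 0 ∧
    ‖x i - f.eval (x i) / denom f x y i - ξ i‖ ≤ θ / (1 - θ) * ‖x i - ξ i‖ ∧
    ∀ κ : ℝ, 0 < κ → (∀ j, j ≠ i → κ ≤ ‖x i - x j‖) →
      ‖x i - f.eval (x i) / denom f x y i - ξ i‖ ≤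
        (n - 1) / ((1 - R) * c * κ ^ 2 * (1 - θ)) * (‖x - ξ‖ ^ 2 * ‖y - ξ‖) := by
  have hR' : 0 < 1 - R := by linarith
  have hθ' : 0 < 1 - θ := by linarith
  have hpos : ∀ j, j ≠ i → 0 < ‖x i - x j‖ := fun j hj =>
    norm_pos_iff.mpr (sub_ne_zero.mpr fun h => hj (hxi h).symm)
  have hxξ : ∀ j, j ≠ i → (1 - R) * ‖x i - x j‖ ≤ ‖x i - ξ j‖ := by
    intro j hj
    have h1 := norm_sub_le_norm_sub_add_norm_sub (x i) (ξ j) (x j)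
    have h2 := hx j i hj
    rw [norm_sub_rev (x j) (x i), norm_sub_rev (x j) (ξ j)] at h2
    linarith
  have hne1 : ∀ j, j ≠ i → x i - ξ j ≠ 0 := fun j hj =>
    norm_pos_iff.mp (lt_of_lt_of_le (mul_pos hR' (hpos j hj)) (hxξ j hj))
  have hne2 : ∀ j, j ≠ i → x i - y j ≠ 0 := fun j hj =>
    norm_pos_iff.mp (lt_of_lt_of_le (mul_pos hc (hpos j hj)) (hxy i j hj.symm))
  have hden := denom_eq_mul_one_sub hf i hne1 hne2
  set P := ∏ j ∈ Finset.univ.erase i, (x i - ξ j) with hP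
  have hP0 : P ≠ 0 := Finset.prod_ne_zero_iff.mpr fun j hj => hne1 j (Finset.ne_of_mem_erase hj)
  have he : f.eval (x i) = a * ((x i - ξ i) * P) := by
    rw [hP, Finset.mul_prod_erase Finset.univ (fun j => x i - ξ j) (Finset.mem_univ i), hf]
    simp [eval_prod]
  set σ := (x i - ξ i) *
    ∑ j ∈ Finset.univ.erase i, (ξ j - y j) * -1 / ((x i - ξ j) * (x i - y j)) with hσ
  have hterm : ∀ j ∈ Finset.univ.erase i,
      ‖(x i - ξ i) * ((ξ j - y j) * -1 / ((x i - ξ j) * (x i - y j)))‖ ≤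
        ‖x i - ξ i‖ * ‖y j - ξ j‖ / (((1 - R) * c) * ‖x i - x j‖ ^ 2) := by
    intro j hj
    have hji := Finset.ne_of_mem_erase hj
    have h1 := hxξ j hji
    have h2 := hxy i j hji.symm
    have h3 := hpos j hji
    have h4 := mul_pos hR' h3
    have h5 := mul_pos hc h3
    rw [norm_mul, norm_div, norm_mul, norm_mul, norm_neg, norm_one, mul_one,
      norm_sub_rev (ξ j), ← mul_div_assoc]
    calc _ ≤ ‖x i - ξ i‖ * ‖y j - ξ j‖ /
          (((1 - R) * ‖x i - x j‖) * (c * ‖x i - x j‖)) := by gcongr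
      _ = _ := by congr 1; ring
  have hn : (0 : ℝ) ≤ n - 1 := by
    have : (1 : ℝ) ≤ n := by exact_mod_cast i.pos
    linarith
  have hσθ : ‖σ‖ ≤ θ := by
    rw [hσ, Finset.mul_sum]
    calc _ ≤ _ := norm_sum_le_of_le _ hterm
      _ ≤ ∑ j ∈ Finset.univ.erase i, b * R ^ 2 / ((1 - R) * c) := by
        refine Finset.sum_le_sum fun j hj => ?_
        have hji := Finset.ne_of_mem_erase hj
        have h1 := hx i j hji.symm
        have h2 := hx j i hji
        rw [norm_sub_rev (x j) (x i)] at h2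
        have h3 := hpos j hji
        calc _ ≤ (R * ‖x i - x j‖) * (b * (R * ‖x i - x j‖)) /
              (((1 - R) * c) * ‖x i - x j‖ ^ 2) := by
              gcongr
              exact (hyξ j).trans (by gcongr)
          _ = _ := by field_simp
      _ = (n - 1) * (b * R ^ 2) / ((1 - R) * c) := by
        rw [Finset.sum_const, nsmul_eq_mul, cast_card_univ_erase]; ring
      _ ≤ θ := by rw [div_le_iff₀ (by positivity)]; exact hbc
  have h1σ : 1 - θ ≤ ‖1 - σ‖ := by
    have h1 := norm_sub_norm_le (1 : K) σ
    rw [norm_one] at h1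
    linarith
  have h1σ0 : 1 - σ ≠ 0 := norm_pos_iff.mp (by linarith)
  -- `σ` already carries the error of `x i` and those of `y`. Bounding it by `θ` gives contraction;
  -- bounding it through `κ` gives the order estimate.
  have herr : x i - f.eval (x i) / denom f x y i - ξ i = -(σ / (1 - σ) * (x i - ξ i)) := by
    rw [hden, he]
    field_simp
    ring
  have hnorm : ‖x i - f.eval (x i) / denom f x y i - ξ i‖ ≤
      ‖σ‖ / (1 - θ) * ‖x i - ξ i‖ := by
    rw [herr, norm_neg, norm_mul, norm_div]
    gcongr
  refine ⟨?_, ?_, ?_⟩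
  · rw [hden]
    exact mul_ne_zero (mul_ne_zero ha hP0) h1σ0
  · exact hnorm.trans (by gcongr)
  · intro κ hκ hκx
    have hxn : ‖x i - ξ i‖ ≤ ‖x - ξ‖ := norm_le_pi_norm (x - ξ) i
    have hσκ : ‖σ‖ ≤ (n - 1) * (‖x - ξ‖ * ‖y - ξ‖ / (((1 - R) * c) * κ ^ 2)) := by
      rw [hσ, Finset.mul_sum]
      calc _ ≤ _ := norm_sum_le_of_le _ hterm
        _ ≤ ∑ j ∈ Finset.univ.erase i, ‖x - ξ‖ * ‖y - ξ‖ / (((1 - R) * c) * κ ^ 2) := by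
          refine Finset.sum_le_sum fun j hj => ?_
          have hji := Finset.ne_of_mem_erase hj
          have h1 := hκx j hji
          have h2 : ‖y j - ξ j‖ ≤ ‖y - ξ‖ := norm_le_pi_norm (y - ξ) j
          gcongr
        _ = _ := by rw [Finset.sum_const, nsmul_eq_mul, cast_card_univ_erase]
    calc _ ≤ _ := hnorm
      _ ≤ (n - 1) * (‖x - ξ‖ * ‖y - ξ‖ / (((1 - R) * c) * κ ^ 2)) / (1 - θ) * ‖x - ξ‖ := by
        gcongr
      _ = _ := by field_simp

/-! ### The threshold and localization of the zeros. -/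

theorem norm_weierstrass_le (f : K[X]) {x : Fin n → K} (hx : Function.Injective x) (i j : Fin n)
    (hij : i ≠ j) : ‖weierstrass f x i‖ ≤ initialFn f x * ‖x i - x j‖ := by
  have : Nonempty {k : Fin n // k ≠ i} := ⟨⟨j, hij.symm⟩⟩
  have hle : minDist x i ≤ ‖x i - x j‖ :=
    ciInf_le (Set.finite_range fun k : {k : Fin n // k ≠ i} => ‖x i - x k‖).bddBelow
      (⟨j, hij.symm⟩ : {k : Fin n // k ≠ i})
  have hpos : 0 < minDist x i := by
    obtain ⟨k, hk⟩ := exists_eq_ciInf_of_finite (f := fun k : {k : Fin n // k ≠ i} => ‖x i - x k‖)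
    rw [minDist, ← hk]
    exact norm_pos_iff.mpr (sub_ne_zero.mpr fun h => k.2 (hx h).symm)
  have h1 : ‖quot (weierstrass f x) (minDist x) i‖ ≤ initialFn f x := norm_le_pi_norm _ i
  rw [quot, Real.norm_of_nonneg (by positivity), div_le_iff₀ hpos] at h1
  exact h1.trans (mul_le_mul_of_nonneg_left hle (norm_nonneg _))

/-- The root `α(t) t` of `r ^ 2 - (1 - (n - 2) t) r + t` for `t` below the threshold. -/
theorem alpha_spec {s t : ℝ} (hs : 3 ≤ s) (hsn : s ^ 2 = 8 * n - 7) (ht : 0 ≤ t)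
    (hts : t < 8 / (3 + s) ^ 2) :
    0 < alpha n t ∧ alpha n t * t ≤ 2 / (3 + s) ∧
      alpha n t * (1 - alpha n t * t - (n - 1) * t) = 1 - alpha n t * t := by
  set b := 1 - ((n : ℝ) - 2) * t with hb
  set R := 2 / (3 + s) with hR
  have h3 : 0 < 3 + s := by linarith
  have hR0 : 0 < R := by positivity
  have hRs : R * (3 + s) = 2 := by rw [hR]; field_simp
  have hn : (n : ℝ) = (s ^ 2 + 7) / 8 := by linarith
  -- The quadratic is negative at `R` exactly below the threshold, so `R` lies between its roots,
  -- above the smaller root `α t`.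
  have hqR : R ^ 2 - b * R + t < 0 := by
    have h1 : t * (3 + s) ^ 2 < 8 := by rwa [lt_div_iff₀ (by positivity)] at hts
    have h2 : 4 * (R ^ 2 - b * R + t) * (3 + s) ^ 2 = (1 + s) * (t * (3 + s) ^ 2 - 8) := by
      rw [hb, hn]
      have : R = 2 / (3 + s) := hR
      rw [this]
      field_simp
      ring
    have h4 : (1 + s) * (t * (3 + s) ^ 2 - 8) < 0 :=
      mul_neg_of_pos_of_neg (by linarith) (by linarith)
    by_contra hcon
    push Not at hcon
    have : 0 ≤ 4 * (R ^ 2 - b * R + t) * (3 + s) ^ 2 := by positivity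
    linarith
  have hb0 : 0 < b := by
    by_contra hcon
    push Not at hcon
    nlinarith [mul_nonneg (neg_nonneg.mpr hcon) hR0.le, sq_nonneg R]
  have hD : (2 * R - b) ^ 2 < b ^ 2 - 4 * t := by nlinarith
  set D := √(b ^ 2 - 4 * t) with hDd
  have hD2 : D ^ 2 = b ^ 2 - 4 * t := Real.sq_sqrt (by nlinarith [sq_nonneg (2 * R - b)])
  have hD0 : 0 ≤ D := Real.sqrt_nonneg _
  have hα : alpha n t = 2 / (b + D) := rfl
  have hαb : alpha n t * (b + D) = 2 := by rw [hα]; field_simp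
  have hrt : alpha n t * t = (b - D) / 2 := by
    rw [hα]
    field_simp
    linear_combination hD2
  refine ⟨by rw [hα]; positivity, ?_, ?_⟩
  · rw [hrt]
    have := abs_lt_of_sq_lt_sq (hD.trans_eq hD2.symm) hD0
    linarith [(abs_lt.mp this).1]
  -- The quadratic for `α t` with one factor `t` removed, valid also for `t = 0`.
  · have : alpha n t * (alpha n t * t) - b * alpha n t + 1 = 0 := by
      rw [hrt]
      linear_combination (-1 / 2) * hαb
    linear_combination -this + alpha n t * hb

/-- Localization: below the threshold the discs with centre `x i` and radius `α * ‖W i‖`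
contain the components of a root-vector. -/
theorem exists_rootVector_near [IsAlgClosed K] (f : K[X]) (hf : f.natDegree = n) (h0 : f ≠ 0)
    {x : Fin n → K} (hx : Function.Injective x) {s : ℝ} (hs : 3 ≤ s) (hsn : s ^ 2 = 8 * n - 7)
    (hE : initialFn f x < 8 / (3 + s) ^ 2) :
    ∃ ξ : Fin n → K, (∀ i, f.IsRoot (ξ i)) ∧
      (∀ i, ‖x i - ξ i‖ ≤ alpha n (initialFn f x) * ‖weierstrass f x i‖) ∧
      ∀ i j, i ≠ j → ‖x i - ξ i‖ ≤ 2 / (3 + s) * ‖x i - x j‖ := by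
  set t := initialFn f x with ht
  have ht0 : 0 ≤ t := norm_nonneg _
  obtain ⟨hα, hr, hαt⟩ := alpha_spec hs hsn ht0 hE
  set α := alpha n t
  have h3 : 0 < 3 + s := by linarith
  have hR : 2 / (3 + s) ≤ 1 / 3 := by rw [div_le_div_iff₀ h3 (by norm_num)]; linarith
  -- With `r = α t`, splitting `s² - 1` into `(s - 1)(s + 1)` gives `(n - 1) r² ≤ (1 - 2r)(1 - r)/2
  -- < (1 - r)²`.
  have hq : (n - 1) * (α * t) ^ 2 < (1 - α * t) ^ 2 := by
    have hn : (n : ℝ) - 1 = (s ^ 2 - 1) / 8 := by linarith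
    have h1 : α * t * (3 + s) ≤ 2 := by rwa [le_div_iff₀ h3] at hr
    have h2 : 0 ≤ α * t := by positivity
    set r := α * t
    have h4 : r * (s - 1) ≤ 2 - 4 * r := by linarith
    have h5 : r * (s + 1) ≤ 2 - 2 * r := by linarith
    have h6 : (r * (s - 1)) * (r * (s + 1)) ≤ (2 - 4 * r) * (2 - 2 * r) :=
      mul_le_mul h4 h5 (mul_nonneg h2 (by linarith)) (by linarith)
    rw [hn]
    nlinarith
  have hW : ∀ i j, i ≠ j → ‖weierstrass f x i‖ ≤ t * ‖x i - x j‖ :=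
    fun i j hij => norm_weierstrass_le f hx i j hij
  choose ξ hξ using exists_root_near f hf h0 hx ht0 hα hW (by linarith) hαt hq
  refine ⟨ξ, fun i => (hξ i).1, fun i => (hξ i).2, fun i j hij => (hξ i).2.trans ?_⟩
  calc α * ‖weierstrass f x i‖ ≤ α * (t * ‖x i - x j‖) := by gcongr; exact hW i j hij
    _ = α * t * ‖x i - x j‖ := by ring
    _ ≤ _ := by gcongr

/-! ### Identification of nearby zeros. -/

/-- The zero near `x i` is unique among the zeros attached to the components of `x`. -/
theorem eq_of_near {x ξ : Fin n → K} (hx : Function.Injective x) {R : ℝ} (hR : R ≤ 1 / 3)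
    (h : ∀ i j, i ≠ j → ‖x i - ξ i‖ ≤ R * ‖x i - x j‖) {i j : Fin n} {z : K}
    (hz : i ≠ j → ‖x i - z‖ ≤ R * ‖x i - x j‖) (hzj : z = ξ j) : i = j := by
  by_contra hij
  have h1 := hz hij
  have h2 := h j i (Ne.symm hij)
  rw [norm_sub_rev, norm_sub_rev (x j) (x i), ← hzj, norm_sub_rev] at h2
  have h3 := norm_sub_le_norm_sub_add_norm_sub (x i) z (x j)
  have h4 : 0 < ‖x i - x j‖ := norm_pos_iff.mpr (sub_ne_zero.mpr fun h => hij (hx h))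
  rw [norm_sub_rev z] at h3
  nlinarith

theorem injective_of_near {x ξ : Fin n → K} (hx : Function.Injective x) {R : ℝ} (hR : R ≤ 1 / 3)
    (h : ∀ i j, i ≠ j → ‖x i - ξ i‖ ≤ R * ‖x i - x j‖) : Function.Injective ξ :=
  fun i j hij => eq_of_near hx hR h (h i j) hij

/-- Any zero attached to `x i` is the one given by the root-vector attached to `x`. -/
theorem eq_root_of_near {f : K[X]} {a : K} (ha : a ≠ 0) {x ξ ξ' : Fin n → K}
    (hf : f = C a * ∏ i, (X - C (ξ i))) (hx : Function.Injective x) {R : ℝ} (hR : R ≤ 1 / 3)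
    (h : ∀ i j, i ≠ j → ‖x i - ξ i‖ ≤ R * ‖x i - x j‖)
    (h' : ∀ i j, i ≠ j → ‖x i - ξ' i‖ ≤ R * ‖x i - x j‖) (hr : ∀ i, f.IsRoot (ξ' i)) :
    ξ' = ξ := by
  funext i
  have h1 := hr i
  rw [IsRoot.def, hf, eval_mul, eval_C, eval_prod] at h1
  obtain ⟨j, -, hj⟩ := Finset.prod_eq_zero_iff.mp ((mul_eq_zero.mp h1).resolve_left ha)
  simp only [eval_sub, eval_X, eval_C, sub_eq_zero] at hj
  rw [hj, eq_of_near hx hR h (h' i j) hj]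

/-! ### Contraction and invariance of closeness. -/

/-- The values `T^(m)(x)` for `m ≥ 1` at a point `x` close to the root-vector `ξ`: they are defined,
contract the error componentwise, and satisfy the recursive error bound of the Ehrlich method. -/
theorem iterFn_succ_spec {f : K[X]} {a : K} {ξ : Fin n → K} (ha : a ≠ 0)
    (hf : f = C a * ∏ i, (X - C (ξ i))) {x : Fin n → K} (hxi : Function.Injective x)
    {s : ℝ} (hs : 3 ≤ s) (hsn : s ^ 2 = 8 * n - 7)
    (hx : ∀ i j, i ≠ j → ‖x i - ξ i‖ ≤ 2 / (3 + s) * ‖x i - x j‖) (m : ℕ) :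
    x ∈ domain f (m + 1) ∧
    (∀ i, ‖iterFn f (m + 1) x i - ξ i‖ ≤ (s - 1) / (s + 7) * ‖x i - ξ i‖) ∧
    ∀ κ : ℝ, 0 < κ → (∀ i j, j ≠ i → κ ≤ ‖x i - x j‖) →
      ‖iterFn f (m + 1) x - ξ‖ ≤
        (n - 1) / ((1 - 2 / (3 + s)) * ((s + 3) / (s + 7)) * κ ^ 2 *
          (1 - (s - 1) / (2 * (s + 3)))) * (‖x - ξ‖ ^ 2 * ‖iterFn f m x - ξ‖) := by
  have h1 : 0 < s - 1 := by linarith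
  have h3 : 0 < 3 + s := by linarith
  have h3' : 0 < s + 3 := by linarith
  have h7 : 0 < s + 7 := by linarith
  have hn : (n : ℝ) - 1 = (s ^ 2 - 1) / 8 := by linarith
  have hn0 : (0 : ℝ) ≤ n - 1 := by rw [hn]; nlinarith
  have hR : 2 / (3 + s) < 1 := by rw [div_lt_one h3]; linarith
  -- `θ = (s - 1)/(2(s + 3))` solves `(n - 1) R² = θ (1 - R)`, and `β = θ / (1 - θ)`.
  have hθ : (s - 1) / (2 * (s + 3)) < 1 := by rw [div_lt_one (by positivity)]; linarith
  have hθβ : (s - 1) / (2 * (s + 3)) / (1 - (s - 1) / (2 * (s + 3))) = (s - 1) / (s + 7) := by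
    have : 1 - (s - 1) / (2 * (s + 3)) = (s + 7) / (2 * (s + 3)) := by field_simp; ring
    rw [this]
    field_simp
  have hR' : 0 < 1 - 2 / (3 + s) := by linarith
  have hθ' : 0 < 1 - (s - 1) / (2 * (s + 3)) := by linarith
  have hc1 : (s + 3) / (s + 7) ≤ 1 := by rw [div_le_one h7]; linarith
  induction m with
  | zero =>
    have hstep := ehrlich_step (y := x) (R := 2 / (3 + s)) (b := 1) (c := 1)
      (θ := (s - 1) / (2 * (s + 3))) ha hf hxi (by positivity) hR zero_le_one one_pos hθ hx
      (fun j => by rw [one_mul]) (fun i j _ => by rw [one_mul]) (le_of_eq (by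
        rw [hn]; field_simp; ring))
    rw [hθβ] at hstep
    refine ⟨⟨Set.mem_univ _, fun i j hij h => hij (hxi h), fun i => (hstep i).1⟩,
      fun i => (hstep i).2.1, fun κ hκ hκx => ?_⟩
    refine (pi_norm_le_iff_of_nonneg (by positivity)).mpr fun i => ?_
    refine ((hstep i).2.2 κ hκ (hκx i)).trans ?_
    -- Here `c = 1`; it is weakened to `(s + 3)/(s + 7)` so that one constant serves every `m`.
    refine mul_le_mul_of_nonneg_right ?_ (by positivity)
    gcongr
  | succ m ih =>
    obtain ⟨hdom, herr, -⟩ := ih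
    set y := iterFn f (m + 1) x with hy
    have hβ1 : (s - 1) / (s + 7) ≤ 1 := by rw [div_le_one h7]; linarith
    have hxy : ∀ i j, i ≠ j → (s + 3) / (s + 7) * ‖x i - x j‖ ≤ ‖x i - y j‖ := by
      intro i j hij
      have e1 := norm_sub_le_norm_sub_add_norm_sub (x i) (y j) (x j)
      have e2 := norm_sub_le_norm_sub_add_norm_sub (y j) (ξ j) (x j)
      have e3 := hx j i hij.symm
      have e4 := herr j
      rw [norm_sub_rev (ξ j)] at e2
      rw [norm_sub_rev (x j) (x i)] at e3
      have e5 : (1 + (s - 1) / (s + 7)) * ‖x j - ξ j‖ ≤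
          (1 + (s - 1) / (s + 7)) * (2 / (3 + s) * ‖x i - x j‖) := by gcongr
      -- `y j` lies within `(1 + β) R ‖x i - x j‖` of `x j`, which leaves this fraction.
      have e6 : (s + 3) / (s + 7) = 1 - (1 + (s - 1) / (s + 7)) * (2 / (3 + s)) := by
        field_simp
        ring
      rw [e6]
      linarith
    have hstep := ehrlich_step (y := y) (R := 2 / (3 + s)) (b := (s - 1) / (s + 7))
      (c := (s + 3) / (s + 7)) (θ := (s - 1) / (2 * (s + 3))) ha hf hxi (by positivity) hR
      (by positivity) (by positivity) hθ hx herr hxy (by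
        -- Since `β ≤ c`, replacing `b = β` by `c` reduces the condition to the identity of the base
        -- case.
        have e1 : ((n : ℝ) - 1) * ((s - 1) / (s + 7) * (2 / (3 + s)) ^ 2) ≤
            ((n : ℝ) - 1) * ((s + 3) / (s + 7) * (2 / (3 + s)) ^ 2) := by
          gcongr; linarith
        refine e1.trans (le_of_eq ?_)
        rw [hn]
        field_simp
        ring)
    rw [hθβ] at hstep
    refine ⟨⟨hdom, ?_, fun i => (hstep i).1⟩,
      fun i => (hstep i).2.1, fun κ hκ hκx => ?_⟩
    · intro i j hij h
      have e1 := hxy i j hij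
      rw [← hy] at h
      rw [h, sub_self, norm_zero] at e1
      have e2 : 0 < ‖y j - x j‖ := by
        rw [← h]
        exact norm_pos_iff.mpr (sub_ne_zero.mpr fun h' => hij (hxi h'))
      have : 0 < (s + 3) / (s + 7) * ‖y j - x j‖ := by positivity
      linarith
    · refine (pi_norm_le_iff_of_nonneg (by positivity)).mpr fun i => ?_
      exact (hstep i).2.2 κ hκ (hκx i)

/-- A map contracting the errors by the critical factor preserves the closeness condition. -/
theorem near_of_contract {x y ξ : Fin n → K} (hxi : Function.Injective x) {s : ℝ} (hs : 3 ≤ s)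
    (hx : ∀ i j, i ≠ j → ‖x i - ξ i‖ ≤ 2 / (3 + s) * ‖x i - x j‖)
    (hy : ∀ i, ‖y i - ξ i‖ ≤ (s - 1) / (s + 7) * ‖x i - ξ i‖) :
    Function.Injective y ∧ ∀ i j, i ≠ j → ‖y i - ξ i‖ ≤ 2 / (3 + s) * ‖y i - y j‖ := by
  have h1 : 0 < s - 1 := by linarith
  have h3 : 0 < 3 + s := by linarith
  have h7 : 0 < s + 7 := by linarith
  -- Each point moves by at most `(1 + β) R = 4/(s + 7)` of the separation, and `1 - 8/(s + 7)` is
  -- exactly `β`.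
  have key : ∀ i j, i ≠ j → (s - 1) / (s + 7) * ‖x i - x j‖ ≤ ‖y i - y j‖ := by
    intro i j hij
    have d : ∀ k l, k ≠ l → ‖x k - y k‖ ≤ 4 / (s + 7) * ‖x k - x l‖ := by
      intro k l hkl
      have e1 := norm_sub_le_norm_sub_add_norm_sub (x k) (ξ k) (y k)
      rw [norm_sub_rev (ξ k)] at e1
      calc ‖x k - y k‖ ≤ (1 + (s - 1) / (s + 7)) * ‖x k - ξ k‖ := by linarith [hy k]
        _ ≤ (1 + (s - 1) / (s + 7)) * (2 / (3 + s) * ‖x k - x l‖) := by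
          gcongr; exact hx k l hkl
        _ = _ := by field_simp; ring
    have e1 := d i j hij
    have e2 := d j i hij.symm
    rw [norm_sub_rev (x j) (x i), norm_sub_rev (x j)] at e2
    have e3 := norm_sub_le_norm_sub_add_norm_sub (x i) (y i) (x j)
    have e4 := norm_sub_le_norm_sub_add_norm_sub (y i) (y j) (x j)
    have e5 : (s - 1) / (s + 7) = 1 - 4 / (s + 7) - 4 / (s + 7) := by field_simp; ring
    rw [e5]
    linarith
  refine ⟨fun i j h => ?_, fun i j hij => ?_⟩
  · by_contra hij
    have e1 := key i j hij
    rw [h, sub_self, norm_zero] at e1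
    have : 0 < ‖x i - x j‖ := norm_pos_iff.mpr (sub_ne_zero.mpr fun h' => hij (hxi h'))
    have : 0 < (s - 1) / (s + 7) * ‖x i - x j‖ := by positivity
    linarith
  · calc ‖y i - ξ i‖ ≤ (s - 1) / (s + 7) * ‖x i - ξ i‖ := hy i
      _ ≤ (s - 1) / (s + 7) * (2 / (3 + s) * ‖x i - x j‖) := by gcongr; exact hx i j hij
      _ = 2 / (3 + s) * ((s - 1) / (s + 7) * ‖x i - x j‖) := by ring
      _ ≤ _ := by gcongr; exact key i j hij

theorem iterate_near {f : K[X]} {a : K} {ξ : Fin n → K} (ha : a ≠ 0)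
    (hf : f = C a * ∏ i, (X - C (ξ i))) {x₀ : Fin n → K} (hxi : Function.Injective x₀)
    {s : ℝ} (hs : 3 ≤ s) (hsn : s ^ 2 = 8 * n - 7)
    (hx : ∀ i j, i ≠ j → ‖x₀ i - ξ i‖ ≤ 2 / (3 + s) * ‖x₀ i - x₀ j‖) (m k : ℕ) :
    Function.Injective (iterate f (m + 1) x₀ k) ∧
      ∀ i j, i ≠ j → ‖iterate f (m + 1) x₀ k i - ξ i‖ ≤
        2 / (3 + s) * ‖iterate f (m + 1) x₀ k i - iterate f (m + 1) x₀ k j‖ := by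
  induction k with
  | zero => exact ⟨hxi, hx⟩
  | succ k ih =>
    have he : iterate f (m + 1) x₀ (k + 1) = iterFn f (m + 1) (iterate f (m + 1) x₀ k) :=
      Function.iterate_succ_apply' _ _ _
    rw [he]
    exact near_of_contract ih.1 hs ih.2 (iterFn_succ_spec ha hf ih.1 hs hsn ih.2 m).2.1

/-! ### Order of convergence. -/

/-- Local convergence with order `2 N + 1` from an initial vector close to a root-vector. -/
theorem convergesWithOrder_of_near {f : K[X]} {a : K} {ξ : Fin n → K} (ha : a ≠ 0)
    (hf : f = C a * ∏ i, (X - C (ξ i))) {x₀ : Fin n → K} (hxi : Function.Injective x₀)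
    {s : ℝ} (hs : 3 ≤ s) (hsn : s ^ 2 = 8 * n - 7)
    (hx : ∀ i j, i ≠ j → ‖x₀ i - ξ i‖ ≤ 2 / (3 + s) * ‖x₀ i - x₀ j‖) (N : ℕ) :
    ConvergesWithOrder (2 * (N + 1) + 1) (iterate f (N + 1) x₀) ξ := by
  have h1 : 0 < s - 1 := by linarith
  have h3 : 0 < 3 + s := by linarith
  have h7 : 0 < s + 7 := by linarith
  have hnear := iterate_near ha hf hxi hs hsn hx N
  have hsucc : ∀ k, iterate f (N + 1) x₀ (k + 1) = iterFn f (N + 1) (iterate f (N + 1) x₀ k) :=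
    fun k => Function.iterate_succ_apply' _ _ _
  have hR : 2 / (3 + s) ≤ 1 / 3 := by rw [div_le_div_iff₀ h3 (by norm_num)]; linarith
  constructor
  · set β := (s - 1) / (s + 7) with hβ
    have hβ0 : 0 ≤ β := by positivity
    have hβ1 : β < 1 := by rw [hβ, div_lt_one h7]; linarith
    have hb : ∀ k, ‖iterate f (N + 1) x₀ k - ξ‖ ≤ β ^ k * ‖x₀ - ξ‖ := by
      intro k
      induction k with
      | zero => rw [pow_zero, one_mul]; exact le_of_eq rfl
      | succ k ih =>
        rw [hsucc]
        refine (pi_norm_le_iff_of_nonneg (by positivity)).mpr fun i => ?_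
        calc _ ≤ β * ‖iterate f (N + 1) x₀ k i - ξ i‖ :=
              (iterFn_succ_spec ha hf (hnear k).1 hs hsn (hnear k).2 N).2.1 i
          _ ≤ β * (β ^ k * ‖x₀ - ξ‖) := by
            gcongr
            exact (norm_le_pi_norm (iterate f (N + 1) x₀ k - ξ) i).trans ih
          _ = _ := by ring
    rw [tendsto_iff_norm_sub_tendsto_zero]
    refine squeeze_zero (fun _ => norm_nonneg _) hb ?_
    simpa using (tendsto_pow_atTop_nhds_zero_of_lt_one hβ0 hβ1).mul_const ‖x₀ - ξ‖
  · have hξ := injective_of_near hxi hR hx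
    obtain ⟨δ, hδ, hδξ⟩ : ∃ δ : ℝ, 0 < δ ∧ ∀ i j, j ≠ i → δ ≤ ‖ξ i - ξ j‖ := by
      have hfin : ∀ p : Fin n × Fin n, ∃ δ : ℝ, 0 < δ ∧ (p.2 ≠ p.1 → δ ≤ ‖ξ p.1 - ξ p.2‖) := by
        intro p
        by_cases hp : p.2 = p.1
        · exact ⟨1, one_pos, fun h => absurd hp h⟩
        · exact ⟨_, norm_pos_iff.mpr (sub_ne_zero.mpr fun h => hp (hξ h).symm), fun _ => le_rfl⟩
      choose δ hδ hδ' using hfin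
      rcases isEmpty_or_nonempty (Fin n × Fin n) with hemp | hne
      · exact ⟨1, one_pos, fun i j => (hemp.false (i, j)).elim⟩
      · obtain ⟨p, hp⟩ := Finite.exists_min δ
        exact ⟨δ p, hδ p, fun i j hij => (hp (i, j)).trans (hδ' (i, j) hij)⟩
    set A := ((n : ℝ) - 1) / ((1 - 2 / (3 + s)) * ((s + 3) / (s + 7)) * (3 / 5 * δ) ^ 2 *
          (1 - (s - 1) / (2 * (s + 3)))) with hA
    have hA0 : 0 ≤ A := by
      have e1 : 2 / (3 + s) < 1 := by linarith
      have e2 : (s - 1) / (2 * (s + 3)) < 1 := by rw [div_lt_one (by positivity)]; linarith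
      have e3 : (0 : ℝ) ≤ n - 1 := by nlinarith
      have e4 := sub_pos.mpr e1
      have e5 := sub_pos.mpr e2
      positivity
    refine ⟨A ^ (N + 1), fun k => ?_⟩
    rw [hsucc]
    obtain ⟨hinj, hnr⟩ := hnear k
    generalize iterate f (N + 1) x₀ k = x at hinj hnr
    -- `δ ≤ ‖ξ i - ξ j‖ ≤ (1 + 2R) ‖x i - x j‖` with `1 + 2R ≤ 5/3`. The bound does not depend on
    -- `k`, hence neither does `A`.
    have hκ : ∀ i j, j ≠ i → 3 / 5 * δ ≤ ‖x i - x j‖ := by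
      intro i j hij
      have e1 := hδξ i j hij
      have e2 := hnr i j hij.symm
      have e3 := hnr j i hij
      rw [norm_sub_rev (x j) (x i)] at e3
      rw [norm_sub_rev] at e2
      have e4 := norm_sub_le_norm_sub_add_norm_sub (ξ i) (x i) (ξ j)
      have e5 := norm_sub_le_norm_sub_add_norm_sub (x i) (x j) (ξ j)
      have e6 : 2 / (3 + s) * ‖x i - x j‖ ≤ 1 / 3 * ‖x i - x j‖ := by gcongr
      linarith
    have hm : ∀ m, ‖iterFn f m x - ξ‖ ≤ A ^ m * ‖x - ξ‖ ^ (2 * m + 1) := by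
      intro m
      induction m with
      | zero => simp [iterFn]
      | succ m ih =>
        calc _ ≤ A * (‖x - ξ‖ ^ 2 * ‖iterFn f m x - ξ‖) :=
              (iterFn_succ_spec ha hf hinj hs hsn hnr m).2.2 _ (by positivity) hκ
          _ ≤ A * (‖x - ξ‖ ^ 2 * (A ^ m * ‖x - ξ‖ ^ (2 * m + 1))) := by gcongr
          _ = _ := by ring
    exact hm (N + 1)

end EhrlichType

/-! ### The semilocal convergence theorem. -/

theorem mainTheorem6 {K : Type*} [NormedField K] [IsAlgClosed K] (f : Polynomial K) (n : ℕ)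
    (hf : f.natDegree = n) (hn : 2 ≤ n) (N : ℕ) (hN : 1 ≤ N)
    (x₀ : Fin n → K) (hx₀ : Function.Injective x₀)
    (hE : EhrlichType.initialFn f x₀ < 8 / (3 + √(8 * (n : ℝ) - 7)) ^ 2) :
    EhrlichType.HasOnlySimpleZeros f ∧
    (∀ k, EhrlichType.iterate f N x₀ k ∈ EhrlichType.domain f N) ∧
    ∃ ξ : Fin n → K, EhrlichType.IsRootVector f ξ ∧
      EhrlichType.ConvergesWithOrder (2 * N + 1) (EhrlichType.iterate f N x₀) ξ ∧
      ∀ k, EhrlichType.initialFn f (EhrlichType.iterate f N x₀ k) <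
          8 / (3 + √(8 * (n : ℝ) - 7)) ^ 2 →
        ∀ i, ‖EhrlichType.iterate f N x₀ k i - ξ i‖ ≤
          EhrlichType.alpha n (EhrlichType.initialFn f (EhrlichType.iterate f N x₀ k)) *
            ‖EhrlichType.weierstrass f (EhrlichType.iterate f N x₀ k) i‖ := by
  -- `T^(0)` is the identity and contracts nothing; the estimates begin at `T^(1)`.
  obtain ⟨N, rfl⟩ : ∃ M, N = M + 1 := ⟨N - 1, by omega⟩
  have hn' : (2 : ℝ) ≤ n := by exact_mod_cast hn
  have h0 : f ≠ 0 := by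
    rintro rfl
    simp at hf
    omega
  have hs : 3 ≤ √(8 * (n : ℝ) - 7) := Real.le_sqrt_of_sq_le (by linarith)
  have hsn : √(8 * (n : ℝ) - 7) ^ 2 = 8 * n - 7 := Real.sq_sqrt (by linarith)
  generalize √(8 * (n : ℝ) - 7) = s at hE hs hsn
  have h3 : 0 < 3 + s := by linarith
  have hR : 2 / (3 + s) ≤ 1 / 3 := by rw [div_le_div_iff₀ h3 (by norm_num)]; linarith
  obtain ⟨ξ, hroot, -, hnear⟩ := EhrlichType.exists_rootVector_near f hf h0 hx₀ hs hsn hE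
  have hξ := EhrlichType.injective_of_near hx₀ hR hnear
  have hprod := EhrlichType.eq_C_mul_prod_of_roots f hf h0 hξ hroot
  have ha : f.leadingCoeff ≠ 0 := leadingCoeff_ne_zero.mpr h0
  have hit := EhrlichType.iterate_near ha hprod hx₀ hs hsn hnear N
  refine ⟨EhrlichType.hasOnlySimpleZeros_of_roots f hf h0 hξ hroot,
    fun k => (EhrlichType.iterFn_succ_spec ha hprod (hit k).1 hs hsn (hit k).2 N).1,
    ξ, ⟨f.leadingCoeff, fun z => ?_⟩,
    EhrlichType.convergesWithOrder_of_near ha hprod hx₀ hs hsn hnear N, fun k hk i => ?_⟩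
  · conv_lhs => rw [hprod]
    simp [eval_prod]
  -- Localization at the `k`-th iterate yields its own root-vector `ξ'`; closeness of both to this
  -- iterate forces `ξ' = ξ`.
  · obtain ⟨ξ', hroot', hα, hnear'⟩ :=
      EhrlichType.exists_rootVector_near f hf h0 (hit k).1 hs hsn hk
    rw [← EhrlichType.eq_root_of_near ha hprod (hit k).1 hR (hit k).2 hnear' hroot']
    exact hα i
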